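/- Let $\mathbb{F}$ be $\mathbb{R}$ or $\mathbb{C}$ (any field of characteristic $0$ will do). Let $\Omega_1,\dots,\Omega_n\subset\mathbb{Z}^n$ be finite sets such that every $\bar\imath\in\Omega_k$ has $k$-th entry at least $-1$, all other entries nonnegative, and $|\bar\imath|=\sum_j \bar\imath_j\ge 1$. Introduce one parameter $a^{(k)}_{\bar\imath}$ for each $k$ and each $\bar\imath\in\Omega_k$; let $\ell$ be the number of parameters, let $a$ be the $\ell$-tuple of all parameters, and for $\nu\in\mathbb{N}_0^\ell$ let $a^\nu$ be the corresponding monomial and $L(\nu)=\sum_q \nu_q\,\bar\imath^{(q)}\in\mathbb{Z}^n$, where $\bar\imath^{(q)}$ is the subscript of the $q$-th parameter. A polynomial $p\in\mathbb{F}[a]$ is an $m$-polynomial if $L(\nu)=m$ for every $\nu$ in its support. Let $\mathcal{M}$ be the set of $m\in \operatorname{im}L$ with all entries $\ge -1$, at most one entry equal to $-1$, and $|m|\ge 0$. Let $M$ be the set of formal vector fields in $x=(x_1,\dots,x_n)$ over $\mathbb{F}[a]$ whose $j$-th component has the form $x_j\sum p_j^{(m)}(a)\,x^m$ $(j=1,\dots,n)$,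 where the sum is over $m\in\mathcal{M}$ with $m_i\ge 0$ for $i\ne j$, and $p_j^{(m)}$ is an $m$-polynomial. Every element of $M$ is a formal sum of terms $(\alpha_\mu\odot x)\,a^\mu x^{L(\mu)}$ with $\alpha_\mu\in\mathbb{F}^n$, where $\odot$ is the entrywise product; its part of level $s$ is the sum of its terms with $|\mu|=s$. Fix $\lambda\in\mathbb{F}^n$ and consider an equation $$\dot x=a(x)=a_0(x)+a_1(x)+a_2(x)+\cdots\in M,\qquad a_0(x)=\lambda\odot x,\qquad a_s(x)=\sum_{|\mu|=s}(\alpha_\mu\odot x)\,a^\mu x^{L(\mu)}\quad(s\ge 1).$$ With $\langle m,\lambda\rangle=\sum_i m_i\lambda_i$, the term with index $\mu$ is called resonant if $\langle L(\mu),\lambda\rangle=0$. The equation is in the normal form up to level $s$ if all non-resonant terms in $a_1,\dots,a_s$ are zero. Theorem. Let $s\ge 1$, assume that $\dot x=a(x)$ is in the normal form up to level $s-1$, and put $$h_s(x)=\sum_{|\mu|=s,\ \langle L(\mu),\lambda\rangle\ne 0}\frac{1}{\langle L(\mu),\lambda\rangle}\,(\alpha_\mu\odot x)\,a^\mu x^{L(\mu)}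 .$$ Then the formal flow $\psi_t$ of $dx/dt=h_s(x)$ with $\psi_0(x)=x$ and $\psi_t(0)=0$ (a tuple of power series in $x$ whose coefficients are polynomials in $a$ and $t$) exists and is unique, and its time-one map $H_s=\exp(h_s)=\psi_1$ satisfies $H_s(y)=y+(\text{terms of degree at least }2\text{ in }y)$. The substitution $x=H_s(y)$, with $y$ the new variable, transforms $\dot x=a(x)$ into exactly one equation $\dot y=b(y)$, i.e. there is exactly one $b$ with $DH_s(y)\,b(y)=a(H_s(y))$. The right-hand side $b$ is in $M$, its part of level $0$ is $\lambda\odot y$, and $\dot y=b(y)$ is in the normal form up to level $s$. -/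

import Mathlib

noncomputable section

namespace LevelNormalForm

/-- `n`-tuples of formal power series in `x_1, …, x_n` with coefficients in `R`:
formal vector fields, and also formal maps, in `n` variables over `R`. -/
abbrev VField (n : ℕ) (R : Type*) : Type _ := Fin n → MvPowerSeries (Fin n) R

/-! ### Flows and changes of variables -/

section Flow

variable {n : ℕ} {R : Type*} [CommRing R]

/-- The value at time `t` of a family of formal maps whose coefficients are polynomials in time. -/
def atTime (t : R) (ψ : VField n (Polynomial R)) : VField n R :=
  fun i => MvPowerSeries.map (Polynomial.evalRingHom t) (ψ i)

/-- `ψ` is the formal flow of `dx/dt = h(x)` with `ψ_0(x) = x`: it fixes the origin, it is the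
identity at time `0`, and `dψ_t(x)/dt = h(ψ_t(x))`, the time derivative being taken in each
coefficient, which is a polynomial in the time `t`. -/
structure IsFlow (h : VField n R) (ψ : VField n (Polynomial R)) : Prop where
  origin : ∀ i, MvPowerSeries.constantCoeff (ψ i) = 0
  init : ∀ i, atTime 0 ψ i = MvPowerSeries.X i
  ode : ∀ i (d : Fin n →₀ ℕ), Polynomial.derivative (MvPowerSeries.coeff d (ψ i)) =
    MvPowerSeries.coeff d (MvPowerSeries.subst ψ (h i))

/-- `H = exp(h)`: `H` is the value at time `1` of the flow of `h`. -/
def IsTimeOneFlow (h H : VField n R) : Prop :=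
  ∃ ψ : VField n (Polynomial R), IsFlow h ψ ∧ H = atTime 1 ψ

/-- `H(y) = y + (terms of degree at least two in y)`, the form of an (invertible) formal change
of coordinates. -/
def IsNearIdentity (H : VField n R) : Prop :=
  ∀ i (d : Fin n →₀ ℕ), d.degree ≤ 1 →
    MvPowerSeries.coeff d (H i) = MvPowerSeries.coeff d (MvPowerSeries.X i)

/-- The matrix of formal partial derivatives of `H`. -/
def jacobian (H : VField n R) : Matrix (Fin n) (Fin n) (MvPowerSeries (Fin n) R) :=
  Matrix.of fun i j => MvPowerSeries.pderiv R j (H i)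

/-- The substitution `x = H(y)` turns `dx/dt = a(x)` into `dy/dt = b(y)`, that is,
`DH(y) b(y) = a(H(y))`. -/
def IsTransformed (a H b : VField n R) : Prop :=
  (jacobian H).mulVec b = fun i => MvPowerSeries.subst H (a i)

end Flow

/-! ### The parameters and the map `L` -/

/-- Admissible families of index sets `Ω_1, …, Ω_n`: each `ī ∈ Ω_k` has `k`-th entry at least
`-1` and the other entries nonnegative, and `|ī| ≥ 1`, so that `x_k x^ī` is a monomial of
degree at least two. -/
def Admissible {n : ℕ} (Ω : Fin n → Finset (Fin n → ℤ)) : Prop :=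
  ∀ k, ∀ m ∈ Ω k, -1 ≤ m k ∧ (∀ i, i ≠ k → 0 ≤ m i) ∧ 1 ≤ ∑ i, m i

/-- The set of parameters `a^{(k)}_ī`, with `1 ≤ k ≤ n` and `ī ∈ Ω_k`. -/
abbrev Param {n : ℕ} (Ω : Fin n → Finset (Fin n → ℤ)) : Type := (k : Fin n) × ↥(Ω k)

/-- The ring `𝔽[a]` of polynomials in the parameters. -/
abbrev ParamRing (F : Type*) [Field F] {n : ℕ} (Ω : Fin n → Finset (Fin n → ℤ)) : Type _ :=
  MvPolynomial (Param Ω) F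

section Grading

variable {F : Type*} [Field F] {n : ℕ} {Ω : Fin n → Finset (Fin n → ℤ)}

/-- The additive map `L(ν) = ∑ ν_q ī^{(q)}`, where `ī^{(q)}` is the subscript of the `q`-th
parameter. -/
def L (ν : Param Ω →₀ ℕ) : Fin n → ℤ := ∑ q : Param Ω, ν q • (q.2 : Fin n → ℤ)

/-- The bilinear pairing `⟨m, λ⟩ = ∑ m_i λ_i`. -/
def pairing (m : Fin n → ℤ) (lam : Fin n → F) : F := ∑ i, (m i : F) * lam i

/-- `p(a)` is an `m`-polynomial: `L(ν) = m` for all `ν` in the support of `p`. -/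
def IsMPolynomial (m : Fin n → ℤ) (p : ParamRing F Ω) : Prop := ∀ ν ∈ p.support, L ν = m

variable (Ω) in
/-- The set `𝓜` of exponents. -/
def expSet : Set (Fin n → ℤ) :=
  {m | (∀ i, -1 ≤ m i) ∧ 0 ≤ ∑ i, m i ∧ m ∈ Set.range (L (Ω := Ω)) ∧
    ∀ i j, m i = -1 → m j = -1 → i = j}

/-- The exponent `m` for which `x_j x^m = x^d`. -/
def shifted (d : Fin n →₀ ℕ) (j : Fin n) : Fin n → ℤ := fun i => (d i : ℤ) - (Pi.single j 1 : Fin n → ℤ) i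

variable (F Ω) in
/-- The module `M`: the formal vector fields whose `j`-th component is
`x_j ∑ p_j^{(m)}(a) x^m`, the sum over the `m ∈ 𝓜` with `m_i ≥ 0` for all `i ≠ j`, where each
`p_j^{(m)}(a)` is an `m`-polynomial. -/
def fieldModule : Set (VField n (ParamRing F Ω)) :=
  {Θ | ∀ j (d : Fin n →₀ ℕ), MvPowerSeries.coeff d (Θ j) ≠ 0 →
    shifted d j ∈ expSet Ω ∧ (∀ i, i ≠ j → 0 ≤ shifted d j i) ∧
      IsMPolynomial (shifted d j) (MvPowerSeries.coeff d (Θ j))}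

/-- The part of level `s` of a vector field: its terms of total degree `s` in the parameters. -/
def levelPart (s : ℕ) (Θ : VField n (ParamRing F Ω)) : VField n (ParamRing F Ω) :=
  fun j d => MvPolynomial.homogeneousComponent s (MvPowerSeries.coeff d (Θ j))

variable (Ω) in
/-- The linear vector field `λ ⊙ x`. -/
def linearField (lam : Fin n → F) : VField n (ParamRing F Ω) :=
  fun j => MvPowerSeries.C (MvPolynomial.C (lam j)) * MvPowerSeries.X j

/-- `x_j x^{L(μ)}` has no negative exponent. -/
def IsMonomialAt (μ : Param Ω →₀ ℕ) (j : Fin n) : Prop := ∀ i, 0 ≤ L μ i + (Pi.single j 1 : Fin n → ℤ) i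

/-- The exponent of `x_j x^{L(μ)}`, when none of its entries is negative. -/
def exponent (μ : Param Ω →₀ ℕ) (j : Fin n) : Fin n →₀ ℕ :=
  Finsupp.equivFunOnFinite.symm fun i => (L μ i + (Pi.single j 1 : Fin n → ℤ) i).toNat

open Classical in
/-- The vector field `(θ ⊙ x) a^μ x^{L(μ)}`. A component whose exponent is not that of a
monomial is put to zero. -/
def termField (θ : Fin n → F) (μ : Param Ω →₀ ℕ) : VField n (ParamRing F Ω) :=
  fun j => if IsMonomialAt μ j then
    MvPowerSeries.monomial (exponent μ j) (MvPolynomial.monomial μ (θ j)) else 0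

open Classical in
/-- The vector `α_μ` of coefficients of the term `(α_μ ⊙ x) a^μ x^{L(μ)}` of a vector field. -/
def termCoeff (Θ : VField n (ParamRing F Ω)) (μ : Param Ω →₀ ℕ) : Fin n → F :=
  fun j => if IsMonomialAt μ j then
    MvPolynomial.coeff μ (MvPowerSeries.coeff (exponent μ j) (Θ j)) else 0

/-- `dx/dt = a(x)` is an equation of the form `a = a_0 + a_1 + a_2 + …` in `M`, where `a_s` is of
level `s` and `a_0(x) = λ ⊙ x`. -/
structure IsEquation (lam : Fin n → F) (a : VField n (ParamRing F Ω)) : Prop where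
  mem : a ∈ fieldModule F Ω
  zero : levelPart 0 a = linearField Ω lam

/-- The equation `dx/dt = a(x)` is in the normal form up to level `s`: all non-resonant terms
of `a_1, …, a_s` are zero, a term `(α_μ ⊙ x) a^μ x^{L(μ)}` being resonant if
`⟨L(μ), λ⟩ = 0`. -/
def InNormalForm (lam : Fin n → F) (s : ℕ) (a : VField n (ParamRing F Ω)) : Prop :=
  ∀ μ : Param Ω →₀ ℕ, 1 ≤ μ.degree → μ.degree ≤ s → pairing (L μ) lam ≠ 0 → termCoeff a μ = 0

open Classical in
/-- The solution `h_s = ∑ ⟨L(μ), λ⟩⁻¹ (α_μ ⊙ x) a^μ x^{L(μ)}` of the homological equation of level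
`s`, the sum over the `μ` with `|μ| = s` and `⟨L(μ), λ⟩ ≠ 0`. -/
def homologicalSolution (lam : Fin n → F) (s : ℕ) (a : VField n (ParamRing F Ω)) :
    VField n (ParamRing F Ω) :=
  ∑ μ ∈ (Finset.univ.finsuppAntidiag s).filter
      (fun μ : Param Ω →₀ ℕ => pairing (L μ) lam ≠ 0),
    termField ((pairing (L μ) lam)⁻¹ • termCoeff a μ) μ

end Grading

end LevelNormalForm

end

open LevelNormalForm

/-!
The idea is that everything is governed by the derivation `X_h = ∑ h_i ∂/∂x_i`, where `h = h_s`.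
As `h` has order at least two in `x`, this derivation raises the order of power series, so that the
Lie series `exp(t X_h) f = ∑ t^k / k! X_h^k f` makes sense, with coefficients polynomial in `t`.
By the Leibniz rule it is a homomorphism of algebras; since it does not lower orders, it is the
substitution of the series `ψ_t = exp(t X_h) x` (`eq_subst_of_order_le`). Hence `ψ` solves the
differential equation (`isFlow_lieSeries`), and `f ∘ H = exp(X_h) f` for all power series `f`
(`subst_atTime_one_lieSeries`). The flow is unique because its coefficients are determined
recursively, degree by degree (`isFlow_unique`).

Two structures are then followed through this formula.

* The module `M` is a weight space: if `x_i` has weight `e_i` and a parameter `a^{(k)}_ī` has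
  weight `-ī`, then `M` consists of the vector fields whose `j`-th component is homogeneous of
  weight `e_j` (`mem_fieldModule_iff`). The derivation `X_h` preserves weights, so `H_i` and
  `a_i ∘ H` have weight `e_i`, and the solution `b` of `DH b = a ∘ H`, which exists and is unique
  because the matrix `DH` is invertible, lies in `M` (`IsTransformed.isWeightHomogeneous`).
* The level is the filtration by powers of the ideal generated by the parameters. Since `h` is of
  level `s ≥ 1`, one has `f ∘ H ≡ f + X_h f` up to terms of level greater than `s`, so that
  `b ≡ a + λ ⊙ h - Dh (λ ⊙ x)` (`IsTransformed.sub_mem_coeffIdeal`). The operator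
  `h ↦ λ ⊙ h - Dh (λ ⊙ x)` multiplies the term with index `μ` by `-⟨L(μ), λ⟩`
  (`coeff_coeff_bracket_linearField`), so by the choice of `h` the non-resonant terms of level `s`
  cancel, while the terms of lower level are unchanged (`InNormalForm.of_sub_mem_level`).
-/

noncomputable section

namespace LevelNormalForm

open MvPowerSeries Finset

section Flows

variable {n : ℕ} {R : Type*} [CommRing R]

/-! ### The derivation of a vector field -/

/-- The derivation `X_h = ∑ i, h_i ∂/∂x_i` of the ring of formal power series defined by a formal
vector field `h`. -/
def lieDerivative (h : VField n R) :
    Derivation R (MvPowerSeries (Fin n) R) (MvPowerSeries (Fin n) R) :=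
  ∑ i, h i • pderiv R i

theorem lieDerivative_apply (h : VField n R) (f : MvPowerSeries (Fin n) R) :
    lieDerivative h f = ∑ i, h i * pderiv R i f := by
  refine (congrFun
    (map_sum Derivation.coeFnAddMonoidHom (fun i => h i • pderiv R i) univ) f).trans ?_
  rw [Finset.sum_apply]
  rfl

@[simp]
theorem lieDerivative_X (h : VField n R) (i : Fin n) : lieDerivative h (X i) = h i := by
  rw [lieDerivative_apply, Finset.sum_eq_single i]
  · rw [pderiv_X_self, mul_one]
  · intro j _ hj
    rw [pderiv_X_of_ne hj.symm, mul_zero]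
  · simp

theorem order_le_order_pderiv_add_one (i : Fin n) (f : MvPowerSeries (Fin n) R) :
    f.order ≤ (pderiv R i f).order + 1 := by
  by_cases hf : pderiv R i f = 0
  · simp [hf]
  obtain ⟨d, hd, hd'⟩ := exists_coeff_ne_zero_and_order (ne_zero_iff_order_finite.mp hf)
  rw [coeff_pderiv] at hd
  refine (order_le (left_ne_zero_of_mul hd)).trans ?_
  rw [← hd', map_add, Finsupp.degree_single]
  simp

theorem le_order_sum {ι : Type*} (s : Finset ι) (f : ι → MvPowerSeries (Fin n) R) (N : ℕ∞)
    (hf : ∀ i ∈ s, N ≤ (f i).order) : N ≤ (∑ i ∈ s, f i).order := by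
  refine le_order fun d hd => ?_
  rw [map_sum]
  exact Finset.sum_eq_zero fun i hi => coeff_of_lt_order (hd.trans_le (hf i hi))

/-- A vector field without constant and linear terms raises the order of power series. -/
theorem order_add_one_le_order_lieDerivative {h : VField n R} (hh : ∀ i, 2 ≤ (h i).order)
    (f : MvPowerSeries (Fin n) R) : f.order + 1 ≤ (lieDerivative h f).order := by
  rw [lieDerivative_apply]
  refine le_order_sum _ _ _ fun i _ => ?_
  calc f.order + 1 ≤ (pderiv R i f).order + 1 + 1 := by
        gcongr
        exact order_le_order_pderiv_add_one i f
    _ = 2 + (pderiv R i f).order := by rw [add_assoc, one_add_one_eq_two, add_comm]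
    _ ≤ (h i).order + (pderiv R i f).order := by
        gcongr
        exact hh i
    _ ≤ _ := le_order_mul

theorem order_add_le_order_iterate_lieDerivative {h : VField n R} (hh : ∀ i, 2 ≤ (h i).order)
    (f : MvPowerSeries (Fin n) R) (k : ℕ) : f.order + k ≤ ((lieDerivative h)^[k] f).order := by
  induction k with
  | zero => simp
  | succ k ih =>
    rw [Function.iterate_succ_apply', Nat.cast_add, Nat.cast_one, ← add_assoc]
    exact (add_le_add_left ih 1).trans (order_add_one_le_order_lieDerivative hh _)

theorem coeff_iterate_lieDerivative_eq_zero {h : VField n R} (hh : ∀ i, 2 ≤ (h i).order)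
    (f : MvPowerSeries (Fin n) R) {k : ℕ} {d : Fin n →₀ ℕ} (hk : d.degree < k) :
    coeff d ((lieDerivative h)^[k] f) = 0 := by
  refine coeff_of_lt_order (lt_of_lt_of_le ?_ (order_add_le_order_iterate_lieDerivative hh f k))
  exact lt_of_lt_of_le (by exact_mod_cast hk) le_add_self

/-- The general Leibniz rule. -/
theorem iterate_derivation_mul {A : Type*} [CommRing A] [Algebra R A] (D : Derivation R A A)
    (k : ℕ) (f g : A) :
    D^[k] (f * g) = ∑ ij ∈ antidiagonal k, k.choose ij.1 • (D^[ij.1] f * D^[ij.2] g) := by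
  induction k with
  | zero => simp
  | succ k ih =>
    rw [sum_antidiagonal_choose_succ_nsmul (M := A) (fun i j => D^[i] f * D^[j] g) k]
    simp only [Function.iterate_succ_apply', ih, map_sum, map_nsmul, Derivation.leibniz,
      smul_eq_mul, smul_add, sum_add_distrib, add_right_inj]
    refine sum_congr rfl fun ⟨i, j⟩ hij ↦ ?_
    rw [k.choose_symm_of_eq_add (mem_antidiagonal.1 hij).symm, mul_comm]

/-! ### Homomorphisms of power series as substitutions -/

theorem order_le_order_sub_truncTotal (f : MvPowerSeries (Fin n) R) (N : ℕ) :
    N ≤ (f - (f.truncTotal N : MvPolynomial (Fin n) R)).order := by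
  refine le_order fun d hd => ?_
  have hd' : d.degree < N := by exact_mod_cast hd
  rw [map_sub, MvPolynomial.coeff_coe, MvPowerSeries.coeff_truncTotal f hd', sub_self]

/-- A homomorphism of algebras of power series that does not lower orders is a substitution:
it is determined by the images of the variables. -/
theorem eq_subst_of_order_le {S : Type*} [CommRing S] [Algebra R S]
    (Φ : MvPowerSeries (Fin n) R →ₐ[R] MvPowerSeries (Fin n) S)
    (hΦ : ∀ f, f.order ≤ (Φ f).order) (f : MvPowerSeries (Fin n) R) :
    Φ f = subst (fun i => Φ (X i)) f := by
  have h1 : ∀ i, 1 ≤ (Φ (X i)).order := fun i =>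
    le_trans (one_le_order_iff_constCoeff_eq_zero.mpr (constantCoeff_X i)) (hΦ _)
  have hs : HasSubst fun i => Φ (X i) :=
    hasSubst_of_constantCoeff_zero fun i => one_le_order_iff_constCoeff_eq_zero.mp (h1 i)
  have hpoly : ∀ p : MvPolynomial (Fin n) R,
      Φ (p : MvPowerSeries (Fin n) R) = subst (fun i => Φ (X i)) (p : MvPowerSeries (Fin n) R) := by
    intro p
    have : (Φ.comp (MvPolynomial.coeToMvPowerSeries.algHom R)) =
        (substAlgHom hs).comp (MvPolynomial.coeToMvPowerSeries.algHom R) := by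
      ext i : 1
      simp [subst_X hs]
    simpa using DFunLike.congr_fun this p
  ext d
  set N := d.degree + 1
  have key : ∀ g : MvPowerSeries (Fin n) R, (N : ℕ∞) ≤ g.order →
      coeff d (Φ g) = 0 ∧ coeff d (subst (fun i => Φ (X i)) g) = 0 := by
    intro g hg
    have hd : (d.degree : ℕ∞) < N := by exact_mod_cast Nat.lt_succ_self _
    refine ⟨coeff_of_lt_order (hd.trans_le (hg.trans (hΦ g))),
      coeff_of_lt_order (hd.trans_le (hg.trans ?_))⟩
    refine le_trans ?_ (le_order_subst hs g)
    calc g.order = 1 * g.order := (one_mul _).symm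
      _ ≤ _ := by
        gcongr
        exact le_iInf h1
  obtain ⟨k1, k2⟩ := key _ (order_le_order_sub_truncTotal f N)
  rw [map_sub, map_sub, sub_eq_zero] at k1
  rw [subst_sub hs, map_sub, sub_eq_zero] at k2
  rw [k1, k2, hpoly]

/-! ### The Lie series -/

section LieSeries

variable [Algebra ℚ R]

/-- The Lie series `exp(t X_h) f = ∑ k, t ^ k / k! X_h ^ k f`. The sum in the coefficient of `x^d`
is cut off after `k = |d|`: if `h` is of order at least two, then the later terms do not
contribute to this coefficient. -/
def lieSeries (h : VField n R) (f : MvPowerSeries (Fin n) R) :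
    MvPowerSeries (Fin n) (Polynomial R) := fun d =>
  ∑ k ∈ range (d.degree + 1),
    Polynomial.monomial k ((k.factorial : ℚ)⁻¹ • coeff d ((lieDerivative h)^[k] f))

variable {h : VField n R}

theorem coeff_lieSeries (d : Fin n →₀ ℕ) (f : MvPowerSeries (Fin n) R) :
    coeff d (lieSeries h f) = ∑ k ∈ range (d.degree + 1),
      Polynomial.monomial k ((k.factorial : ℚ)⁻¹ • coeff d ((lieDerivative h)^[k] f)) := rfl

theorem coeff_coeff_lieSeries (hh : ∀ i, 2 ≤ (h i).order) (f : MvPowerSeries (Fin n) R)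
    (d : Fin n →₀ ℕ) (k : ℕ) : (coeff d (lieSeries h f)).coeff k =
      (k.factorial : ℚ)⁻¹ • coeff d ((lieDerivative h)^[k] f) := by
  simp only [coeff_lieSeries, Polynomial.finsetSum_coeff, Polynomial.coeff_monomial,
    Finset.sum_ite_eq', mem_range]
  split_ifs with hk
  · rfl
  · rw [coeff_iterate_lieDerivative_eq_zero hh f (by omega), smul_zero]

omit [Algebra ℚ R] in
theorem iterate_lieDerivative_C (r : R) {k : ℕ} (hk : k ≠ 0) :
    (lieDerivative h)^[k] (C r) = 0 := by
  obtain ⟨k, rfl⟩ := Nat.exists_eq_succ_of_ne_zero hk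
  have h0 : lieDerivative h (C r) = 0 := by simp [lieDerivative_apply]
  rw [Function.iterate_succ_apply, h0, iterate_map_zero]

theorem lieSeries_C (hh : ∀ i, 2 ≤ (h i).order) (r : R) :
    lieSeries h (C r) = C (Polynomial.C r) := by
  ext d k
  rw [coeff_coeff_lieSeries hh]
  rcases eq_or_ne k 0 with rfl | hk
  · simp only [Nat.factorial_zero, Nat.cast_one, inv_one, one_smul, Function.iterate_zero, id_eq,
      coeff_C]
    split_ifs <;> simp
  · rw [iterate_lieDerivative_C r hk, coeff_C]
    split_ifs <;> simp [Polynomial.coeff_C, hk]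

theorem lieSeries_add (hh : ∀ i, 2 ≤ (h i).order) (f g : MvPowerSeries (Fin n) R) :
    lieSeries h (f + g) = lieSeries h f + lieSeries h g := by
  ext d k
  simp only [map_add, Polynomial.coeff_add, coeff_coeff_lieSeries hh, iterate_map_add, smul_add]

/-- The exponential of a derivation is multiplicative. -/
theorem lieSeries_mul (hh : ∀ i, 2 ≤ (h i).order) (f g : MvPowerSeries (Fin n) R) :
    lieSeries h (f * g) = lieSeries h f * lieSeries h g := by
  classical
  ext d k
  simp only [coeff_mul, Polynomial.finsetSum_coeff, Polynomial.coeff_mul,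
    coeff_coeff_lieSeries hh, iterate_derivation_mul, map_sum, map_nsmul, smul_sum]
  rw [Finset.sum_comm]
  refine sum_congr rfl fun de _ => sum_congr rfl fun ij hij => ?_
  rw [HasAntidiagonal.mem_antidiagonal] at hij
  rw [smul_mul_smul_comm, ← Nat.cast_smul_eq_nsmul ℚ, smul_smul]
  congr 1
  rw [← hij, Nat.cast_add_choose]
  have := Nat.cast_ne_zero (R := ℚ).mpr (Nat.factorial_ne_zero (ij.1 + ij.2))
  field_simp

/-- The Lie series as a homomorphism of algebras. -/
def lieSeriesHom (hh : ∀ i, 2 ≤ (h i).order) :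
    MvPowerSeries (Fin n) R →ₐ[R] MvPowerSeries (Fin n) (Polynomial R) where
  toFun := lieSeries h
  map_zero' := by simpa using lieSeries_C hh 0
  map_one' := by simpa using lieSeries_C hh 1
  map_add' := lieSeries_add hh
  map_mul' := lieSeries_mul hh
  commutes' r := by
    rw [← c_eq_algebraMap, lieSeries_C hh, MvPowerSeries.algebraMap_apply,
      Polynomial.algebraMap_apply, Algebra.algebraMap_self_apply]

theorem order_le_order_lieSeries (hh : ∀ i, 2 ≤ (h i).order) (f : MvPowerSeries (Fin n) R) :
    f.order ≤ (lieSeries h f).order := by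
  refine le_order fun d hd => ?_
  ext k
  rw [coeff_coeff_lieSeries hh, coeff_of_lt_order, smul_zero, Polynomial.coeff_zero]
  exact hd.trans_le (le_self_add.trans (order_add_le_order_iterate_lieDerivative hh f k))

theorem derivative_coeff_lieSeries (hh : ∀ i, 2 ≤ (h i).order) (f : MvPowerSeries (Fin n) R)
    (d : Fin n →₀ ℕ) : Polynomial.derivative (coeff d (lieSeries h f)) =
      coeff d (lieSeries h (lieDerivative h f)) := by
  ext k
  rw [Polynomial.coeff_derivative, coeff_coeff_lieSeries hh, coeff_coeff_lieSeries hh,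
    Function.iterate_succ_apply, mul_comm, ← Nat.cast_add_one, ← nsmul_eq_mul,
    ← Nat.cast_smul_eq_nsmul ℚ, smul_smul]
  congr 1
  rw [Nat.factorial_succ]
  push_cast
  field_simp

/-- The Lie series of the coordinate functions form the flow of the vector field. -/
theorem isFlow_lieSeries (hh : ∀ i, 2 ≤ (h i).order) :
    IsFlow h fun i => lieSeries h (X i) where
  origin i := by
    rw [← one_le_order_iff_constCoeff_eq_zero]
    exact le_trans (one_le_order_iff_constCoeff_eq_zero.mpr (constantCoeff_X i))
      (order_le_order_lieSeries hh _)
  init i := by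
    ext d : 1
    rw [atTime, coeff_map, Polynomial.coe_evalRingHom, ← Polynomial.coeff_zero_eq_eval_zero,
      coeff_coeff_lieSeries hh]
    simp
  ode i d := by
    rw [derivative_coeff_lieSeries hh, lieDerivative_X]
    exact congrArg _ (eq_subst_of_order_le (lieSeriesHom hh) (order_le_order_lieSeries hh) (h i))

/-- Composition with the time-one map of the flow is the Lie series at time one. -/
theorem subst_atTime_one_lieSeries (hh : ∀ i, 2 ≤ (h i).order) (f : MvPowerSeries (Fin n) R) :
    subst (atTime 1 fun i => lieSeries h (X i)) f =
      MvPowerSeries.map (Polynomial.evalRingHom 1) (lieSeries h f) :=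
  (eq_subst_of_order_le
    ((mapAlgHom (Polynomial.aeval (1 : R))).comp (lieSeriesHom hh))
    (fun f => (order_le_order_lieSeries hh f).trans
      (le_order_map (Polynomial.aeval (1 : R)).toRingHom)) f).symm

theorem coeff_map_eval_one_lieSeries (hh : ∀ i, 2 ≤ (h i).order) (f : MvPowerSeries (Fin n) R)
    (d : Fin n →₀ ℕ) {N : ℕ} (hN : d.degree < N) :
    coeff d (MvPowerSeries.map (Polynomial.evalRingHom 1) (lieSeries h f)) =
      ∑ k ∈ range N, (k.factorial : ℚ)⁻¹ • coeff d ((lieDerivative h)^[k] f) := by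
  rw [coeff_map, coeff_lieSeries, map_sum]
  simp only [Polynomial.coe_evalRingHom, Polynomial.eval_monomial, one_pow, mul_one]
  refine sum_subset (range_subset_range.mpr hN) fun k _ hk => ?_
  rw [mem_range, not_lt] at hk
  rw [coeff_iterate_lieDerivative_eq_zero hh f hk, smul_zero]

end LieSeries

/-! ### Uniqueness of the flow -/

section Uniqueness

/-- The monomials of degree at least two in power series without constant term agree to one order
more than the power series themselves. The two series are given an order `m` of vanishing and
an order `N + m - 1` of contact, which makes the statement multiplicative. -/
theorem order_contact_mul {N m₁ m₂ : ℕ∞} {A₁ B₁ A₂ B₂ : MvPowerSeries (Fin n) R}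
    (h₁ : m₁ ≤ B₁.order ∧ m₁ ≤ A₁.order ∧ N + m₁ ≤ (A₁ - B₁).order + 1)
    (h₂ : m₂ ≤ B₂.order ∧ m₂ ≤ A₂.order ∧ N + m₂ ≤ (A₂ - B₂).order + 1) :
    m₁ + m₂ ≤ (B₁ * B₂).order ∧ m₁ + m₂ ≤ (A₁ * A₂).order ∧
      N + (m₁ + m₂) ≤ (A₁ * A₂ - B₁ * B₂).order + 1 := by
  refine ⟨(add_le_add h₁.1 h₂.1).trans le_order_mul,
    (add_le_add h₁.2.1 h₂.2.1).trans le_order_mul, ?_⟩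
  have e : A₁ * A₂ - B₁ * B₂ = (A₁ - B₁) * A₂ + B₁ * (A₂ - B₂) := by ring
  rw [e]
  have l1 : N + (m₁ + m₂) ≤ ((A₁ - B₁) * A₂).order + 1 :=
    calc N + (m₁ + m₂) = (N + m₁) + m₂ := (add_assoc _ _ _).symm
      _ ≤ ((A₁ - B₁).order + 1) + A₂.order := add_le_add h₁.2.2 h₂.2.1
      _ = ((A₁ - B₁).order + A₂.order) + 1 := add_right_comm _ _ _
      _ ≤ _ := by
        gcongr
        exact le_order_mul
  have l2 : N + (m₁ + m₂) ≤ (B₁ * (A₂ - B₂)).order + 1 :=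
    calc N + (m₁ + m₂) = m₁ + (N + m₂) := add_left_comm _ _ _
      _ ≤ B₁.order + ((A₂ - B₂).order + 1) := add_le_add h₁.1 h₂.2.2
      _ = (B₁.order + (A₂ - B₂).order) + 1 := (add_assoc _ _ _).symm
      _ ≤ _ := by
        gcongr
        exact le_order_mul
  refine le_trans ?_ (add_le_add_left min_order_le_add 1)
  rcases min_choice ((A₁ - B₁) * A₂).order (B₁ * (A₂ - B₂)).order with h | h <;> rw [h]
  exacts [l1, l2]

theorem order_contact_prod {ψ φ : VField n R} {N : ℕ∞} (hψ : ∀ i, 1 ≤ (ψ i).order)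
    (hφ : ∀ i, 1 ≤ (φ i).order) (hN : ∀ i, N ≤ (ψ i - φ i).order) (e : Fin n →₀ ℕ) :
    N + e.degree ≤
      ((e.prod fun i k => ψ i ^ k) - (e.prod fun i k => φ i ^ k)).order + 1 := by
  suffices H : (e.degree : ℕ∞) ≤ (e.prod fun i k => φ i ^ k).order ∧
      (e.degree : ℕ∞) ≤ (e.prod fun i k => ψ i ^ k).order ∧ N + e.degree ≤
      ((e.prod fun i k => ψ i ^ k) - (e.prod fun i k => φ i ^ k)).order + 1 from H.2.2
  induction e using Finsupp.induction_linear with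
  | zero => simp
  | add e₁ e₂ h₁ h₂ =>
    have hp : ∀ ψ : VField n R, ((e₁ + e₂).prod fun i k => ψ i ^ k) =
        (e₁.prod fun i k => ψ i ^ k) * (e₂.prod fun i k => ψ i ^ k) := fun ψ =>
      Finsupp.prod_add_index' (by simp) (by intros; rw [pow_add])
    rw [hp, hp, map_add, Nat.cast_add]
    exact order_contact_mul h₁ h₂
  | single i k =>
    simp only [Finsupp.degree_single, pow_zero, Finsupp.prod_single_index]
    induction k with
    | zero => simp
    | succ k ih =>
      rw [pow_succ, pow_succ, Nat.cast_add, Nat.cast_one]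
      exact order_contact_mul ih ⟨hφ i, hψ i, by gcongr; exact hN i⟩

theorem order_subst_sub_subst {S : Type*} [CommRing S] [Algebra R S] {ψ φ : VField n S} {N : ℕ∞}
    (hψ : ∀ i, 1 ≤ (ψ i).order) (hφ : ∀ i, 1 ≤ (φ i).order) (hN : ∀ i, N ≤ (ψ i - φ i).order)
    {f : MvPowerSeries (Fin n) R} (hf : 2 ≤ f.order) :
    N + 1 ≤ (subst ψ f - subst φ f).order := by
  have sψ : HasSubst ψ :=
    hasSubst_of_constantCoeff_zero fun i => one_le_order_iff_constCoeff_eq_zero.mp (hψ i)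
  have sφ : HasSubst φ :=
    hasSubst_of_constantCoeff_zero fun i => one_le_order_iff_constCoeff_eq_zero.mp (hφ i)
  refine le_order fun d hd => ?_
  rw [map_sub, coeff_subst sψ, coeff_subst sφ, sub_eq_zero]
  refine finsum_congr fun e => ?_
  rcases lt_or_ge e.degree 2 with he | he
  · rw [coeff_of_lt_order (lt_of_lt_of_le (by exact_mod_cast he) hf), zero_smul, zero_smul]
  · congr 1
    rw [← sub_eq_zero, ← map_sub]
    refine coeff_of_lt_order (hd.trans_le ?_)
    rw [← ENat.add_le_add_iff_right ENat.one_ne_top, add_assoc, one_add_one_eq_two]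
    refine le_trans ?_ (order_contact_prod hψ hφ hN e)
    gcongr
    exact_mod_cast he

/-- The flow is unique: if two flows agree up to order `N`, then so do their time derivatives up to
order `N + 1`, as `h` is of order at least two, and the flows agree at time zero. -/
theorem isFlow_unique [Algebra ℚ R] {h : VField n R} (hh : ∀ i, 2 ≤ (h i).order)
    {ψ φ : VField n (Polynomial R)} (hψ : IsFlow h ψ) (hφ : IsFlow h φ) : ψ = φ := by
  have oψ := fun i => one_le_order_iff_constCoeff_eq_zero.mpr (hψ.origin i)
  have oφ := fun i => one_le_order_iff_constCoeff_eq_zero.mpr (hφ.origin i)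
  have key : ∀ N : ℕ, ∀ i, (N : ℕ∞) ≤ (ψ i - φ i).order := by
    intro N
    induction N with
    | zero => simp
    | succ N ih =>
      intro i
      refine nat_le_order fun d hd => ?_
      have hd' : Polynomial.derivative (coeff d (ψ i - φ i)) = 0 := by
        rw [map_sub, Polynomial.derivative_sub, hψ.ode, hφ.ode, ← map_sub]
        refine coeff_of_lt_order (lt_of_lt_of_le ?_ (order_subst_sub_subst oψ oφ ih (hh i)))
        exact_mod_cast hd
      have h0 : (coeff d (ψ i - φ i)).coeff 0 = 0 := by
        have e : coeff d (atTime 0 ψ i) = coeff d (atTime 0 φ i) := by rw [hψ.init, hφ.init]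
        simp only [atTime, coeff_map, Polynomial.coe_evalRingHom,
          ← Polynomial.coeff_zero_eq_eval_zero] at e
        rw [map_sub, Polynomial.coeff_sub, e, sub_self]
      ext k
      cases k with
      | zero => rw [h0, Polynomial.coeff_zero]
      | succ k =>
        have hk := congrArg (fun p => Polynomial.coeff p k) hd'
        simp only [Polynomial.coeff_derivative, Polynomial.coeff_zero] at hk
        rw [← Nat.cast_add_one, mul_comm, ← nsmul_eq_mul, ← Nat.cast_smul_eq_nsmul ℚ] at hk
        rw [Polynomial.coeff_zero, ← inv_smul_smul₀ (Nat.cast_ne_zero (R := ℚ).mpr k.succ_ne_zero)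
          (Polynomial.coeff _ _), hk, smul_zero]
  funext i
  rw [← sub_eq_zero, ← order_eq_top_iff]
  exact ENat.eq_top_iff_forall_ge.mpr fun N => key N i

theorem IsTimeOneFlow.eq_atTime_lieSeries [Algebra ℚ R] {h : VField n R}
    (hh : ∀ i, 2 ≤ (h i).order) {H : VField n R} (hH : IsTimeOneFlow h H) :
    H = atTime 1 fun i => lieSeries h (X i) := by
  obtain ⟨ψ, hψ, rfl⟩ := hH
  rw [isFlow_unique hh hψ (isFlow_lieSeries hh)]

end Uniqueness

end Flows

/-! ### Power series with coefficients in an ideal -/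

section CoeffIdeal

variable {n : ℕ} {R : Type*} [CommRing R]

/-- The ideal of the power series all of whose coefficients lie in `I`. -/
def coeffIdeal (I : Ideal R) : Ideal (MvPowerSeries (Fin n) R) :=
  RingHom.ker (MvPowerSeries.map (Ideal.Quotient.mk I))

variable {I J : Ideal R} {f g : MvPowerSeries (Fin n) R}

theorem mem_coeffIdeal : f ∈ coeffIdeal I ↔ ∀ d, coeff d f ∈ I := by
  simp only [coeffIdeal, RingHom.mem_ker, MvPowerSeries.ext_iff, coeff_map, coeff_zero,
    Ideal.Quotient.eq_zero_iff_mem]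

theorem coeffIdeal_mono (h : I ≤ J) (hf : f ∈ coeffIdeal I) : f ∈ coeffIdeal J :=
  mem_coeffIdeal.mpr fun d => h (mem_coeffIdeal.mp hf d)

theorem mul_mem_coeffIdeal_mul (hf : f ∈ coeffIdeal I) (hg : g ∈ coeffIdeal J) :
    f * g ∈ coeffIdeal (I * J) := by
  classical
  refine mem_coeffIdeal.mpr fun d => ?_
  rw [coeff_mul]
  exact Ideal.sum_mem _ fun ij _ =>
    Ideal.mul_mem_mul (mem_coeffIdeal.mp hf _) (mem_coeffIdeal.mp hg _)

theorem mul_mem_coeffIdeal_pow_add {k l : ℕ} (hf : f ∈ coeffIdeal (I ^ k))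
    (hg : g ∈ coeffIdeal (I ^ l)) : f * g ∈ coeffIdeal (I ^ (k + l)) := by
  rw [pow_add]
  exact mul_mem_coeffIdeal_mul hf hg

theorem pderiv_mem_coeffIdeal (i : Fin n) (hf : f ∈ coeffIdeal I) :
    pderiv R i f ∈ coeffIdeal I := by
  refine mem_coeffIdeal.mpr fun d => ?_
  rw [coeff_pderiv]
  exact Ideal.mul_mem_right _ _ (mem_coeffIdeal.mp hf _)

variable {h : VField n R}

theorem lieDerivative_mem_coeffIdeal {k l : ℕ} (hh : ∀ i, h i ∈ coeffIdeal (I ^ k))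
    (hf : f ∈ coeffIdeal (I ^ l)) : lieDerivative h f ∈ coeffIdeal (I ^ (k + l)) := by
  rw [lieDerivative_apply]
  exact Ideal.sum_mem _ fun i _ => mul_mem_coeffIdeal_pow_add (hh i) (pderiv_mem_coeffIdeal i hf)

/-- If `h` is of level `s ≥ 1`, then composition with `exp(h)` is `1 + X_h` up to terms of level
greater than `s`. -/
theorem subst_timeOne_sub_mem_coeffIdeal [Algebra ℚ R] (ho : ∀ i, 2 ≤ (h i).order) {s : ℕ}
    (hs : 1 ≤ s) (hh : ∀ i, h i ∈ coeffIdeal (I ^ s)) (f : MvPowerSeries (Fin n) R) :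
    MvPowerSeries.map (Polynomial.evalRingHom 1) (lieSeries h f) - f - lieDerivative h f ∈
      coeffIdeal (I ^ (s + 1)) := by
  have h1 : lieDerivative h f ∈ coeffIdeal (I ^ s) :=
    lieDerivative_mem_coeffIdeal (l := 0) hh (mem_coeffIdeal.mpr fun d => by simp)
  have hk : ∀ k, (lieDerivative h)^[k + 2] f ∈ coeffIdeal (I ^ (s + 1)) := by
    intro k
    induction k with
    | zero =>
      exact coeffIdeal_mono (Ideal.pow_le_pow_right (by omega)) (lieDerivative_mem_coeffIdeal hh h1)
    | succ k ih =>
      rw [add_right_comm, Function.iterate_succ_apply']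
      exact coeffIdeal_mono (Ideal.pow_le_pow_right (by omega)) (lieDerivative_mem_coeffIdeal hh ih)
  refine mem_coeffIdeal.mpr fun d => ?_
  rw [map_sub, map_sub, coeff_map_eval_one_lieSeries ho f d (N := d.degree + 2) (by omega),
    sum_range_succ', sum_range_succ']
  simp only [zero_add, Nat.factorial_one, Nat.factorial_zero, Nat.cast_one, inv_one, one_smul,
    Function.iterate_one, Function.iterate_zero, id_eq]
  rw [add_assoc, add_sub_assoc, add_sub_assoc, add_sub_cancel_right, sub_self,
    add_zero]
  exact Ideal.sum_mem _ fun k _ => Submodule.smul_of_tower_mem _ _ (mem_coeffIdeal.mp (hk k) d)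

end CoeffIdeal

/-! ### Linear systems with near-identity matrices -/

section NearIdentity

variable {n : ℕ} {R : Type*} [CommRing R] {H : VField n R}

theorem IsNearIdentity.constantCoeff_jacobian (hH : IsNearIdentity H) (i j : Fin n) :
    constantCoeff (jacobian H i j) = (1 : Matrix (Fin n) (Fin n) R) i j := by
  rw [jacobian, Matrix.of_apply, ← coeff_zero_eq_constantCoeff_apply, coeff_pderiv,
    hH i _ (by simp), Matrix.one_apply, coeff_X]
  simp [Finsupp.single_left_inj, eq_comm]

theorem IsNearIdentity.isUnit_jacobian (hH : IsNearIdentity H) : IsUnit (jacobian H) := by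
  rw [Matrix.isUnit_iff_isUnit_det, MvPowerSeries.isUnit_iff_constantCoeff, RingHom.map_det]
  have : (constantCoeff.mapMatrix (jacobian H)) = 1 := by
    ext i j
    exact hH.constantCoeff_jacobian i j
  rw [this, Matrix.det_one]
  exact isUnit_one

theorem IsNearIdentity.existsUnique_isTransformed (hH : IsNearIdentity H) (a : VField n R) :
    ∃! b, IsTransformed a H b := by
  refine Function.Bijective.existsUnique ⟨Matrix.mulVec_injective_of_isUnit hH.isUnit_jacobian,
    fun v => ⟨((jacobian H)⁻¹).mulVec v, ?_⟩⟩ _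
  rw [Matrix.mulVec_mulVec, Matrix.mul_nonsing_inv _
    ((Matrix.isUnit_iff_isUnit_det _).mp hH.isUnit_jacobian), Matrix.one_mulVec]

/-- The equation `DH b = a ∘ H` as a fixed point equation for `b`. -/
theorem IsTransformed.eq_sub {a b : VField n R} (hb : IsTransformed a H b) (i : Fin n) :
    b i = subst H (a i) - ∑ j, pderiv R j (H i - X i) * b j := by
  have := congrFun hb i
  simp only [Matrix.mulVec, dotProduct, jacobian, Matrix.of_apply] at this
  rw [← this]
  have hX : ∑ j, pderiv R j (X i) * b j = b i := by
    rw [Finset.sum_eq_single i]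
    · rw [pderiv_X_self, one_mul]
    · intro j _ hj
      rw [pderiv_X_of_ne hj.symm, zero_mul]
    · simp
  simp only [map_sub, sub_mul, Finset.sum_sub_distrib, hX, sub_sub_cancel]

end NearIdentity

/-! ### The homological equation -/

section HomologicalEquation

variable {n : ℕ} {R : Type*} [CommRing R] {I : Ideal R} {h : VField n R}

/-- The homological equation: modulo terms of level greater than `s`, the substitution `exp(h)`
adds the Lie bracket `X_h a₀ - X_{a₀} h` to the vector field. Here the level is the exponent of the
power of `I` in which the coefficients lie, and `a₀` is the part of level zero of `a`. -/
theorem IsTransformed.sub_mem_coeffIdeal [Algebra ℚ R] {a a₀ H b : VField n R}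
    (hb : IsTransformed a H b) (ho : ∀ i, 2 ≤ (h i).order) {s : ℕ} (hs : 1 ≤ s)
    (hh : ∀ i, h i ∈ coeffIdeal (I ^ s)) (ha : ∀ i, a i - a₀ i ∈ coeffIdeal (I ^ 1))
    (hH : H = atTime 1 fun i => lieSeries h (X i)) (i : Fin n) :
    b i - a i ∈ coeffIdeal (I ^ s) ∧
      b i - (a i + lieDerivative h (a₀ i) - lieDerivative a₀ (h i)) ∈
        coeffIdeal (I ^ (s + 1)) := by
  have top : ∀ f, f ∈ coeffIdeal (n := n) (I ^ 0) := fun f => mem_coeffIdeal.mpr fun d => by simp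
  have weaken : ∀ {k l : ℕ} {f}, k ≤ l →
      f ∈ coeffIdeal (n := n) (I ^ l) → f ∈ coeffIdeal (I ^ k) :=
    fun hkl => coeffIdeal_mono (Ideal.pow_le_pow_right hkl)
  have hsub : ∀ f, subst H f - f - lieDerivative h f ∈ coeffIdeal (I ^ (s + 1)) := by
    intro f
    rw [hH, subst_atTime_one_lieSeries ho]
    exact subst_timeOne_sub_mem_coeffIdeal ho hs hh f
  have hHx : ∀ i, H i - X i - h i ∈ coeffIdeal (I ^ (s + 1)) := by
    intro i
    have := subst_timeOne_sub_mem_coeffIdeal ho hs hh (X i)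
    rw [lieDerivative_X] at this
    rw [hH]
    exact this
  have hHx' : ∀ i, H i - X i ∈ coeffIdeal (I ^ s) := fun i =>
    (Submodule.sub_mem_iff_left _ (hh i)).mp (weaken s.le_succ (hHx i))
  -- `a ∘ H` differs from `a`, and `DH` from the identity, by terms of level at least `s`.
  have first : ∀ i, b i - a i ∈ coeffIdeal (I ^ s) := by
    intro i
    have e : b i - a i = (subst H (a i) - a i - lieDerivative h (a i)) + lieDerivative h (a i) -
        ∑ j, pderiv _ j (H i - X i) * b j := by
      rw [hb.eq_sub i]
      ring
    rw [e]
    refine Submodule.sub_mem _ (Ideal.add_mem _ (weaken s.le_succ (hsub _))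
      (lieDerivative_mem_coeffIdeal (l := 0) hh (top _))) (Ideal.sum_mem _ fun j _ => ?_)
    exact mul_mem_coeffIdeal_pow_add (l := 0) (pderiv_mem_coeffIdeal j (hHx' i)) (top _)
  refine ⟨first i, ?_⟩
  -- In the term `Dh b`, of level at least `s`, only the part `a₀` of level zero of `b` counts.
  have e : b i - (a i + lieDerivative h (a₀ i) - lieDerivative a₀ (h i)) =
      (subst H (a i) - a i - lieDerivative h (a i)) + lieDerivative h (a i - a₀ i) -
        ∑ j, (pderiv _ j (H i - X i - h i) * b j +
          pderiv _ j (h i) * ((b j - a j) + (a j - a₀ j))) := by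
    have e' : ∀ j, pderiv _ j (H i - X i - h i) * b j +
          pderiv _ j (h i) * ((b j - a j) + (a j - a₀ j)) =
        pderiv _ j (H i - X i) * b j - a₀ j * pderiv _ j (h i) := by
      intro j
      rw [map_sub _ (H i - X i)]
      ring
    rw [hb.eq_sub i, lieDerivative_apply a₀, Finset.sum_congr rfl fun j _ => e' j,
      Finset.sum_sub_distrib, map_sub]
    ring
  rw [e]
  refine Submodule.sub_mem _ (Ideal.add_mem _ (hsub _) (lieDerivative_mem_coeffIdeal hh (ha i)))
    (Ideal.sum_mem _ fun j _ => Ideal.add_mem _ ?_ ?_)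
  · exact mul_mem_coeffIdeal_pow_add (l := 0) (pderiv_mem_coeffIdeal j (hHx i)) (top _)
  · exact mul_mem_coeffIdeal_pow_add (pderiv_mem_coeffIdeal j (hh i))
      (Ideal.add_mem _ (weaken hs (first j)) (ha j))

end HomologicalEquation

section Grading

variable {F : Type*} [Field F] {n : ℕ} {Ω : Fin n → Finset (Fin n → ℤ)}

/-! ### The weight grading -/

theorem L_add (μ ν : Param Ω →₀ ℕ) : L (μ + ν) = L μ + L ν := by
  simp only [L, Finsupp.add_apply, add_smul, Finset.sum_add_distrib]

theorem L_zero : L (0 : Param Ω →₀ ℕ) = 0 := by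
  simp [L]

theorem Admissible.degree_le_sum_L (hΩ : Admissible Ω) (ν : Param Ω →₀ ℕ) :
    (ν.degree : ℤ) ≤ ∑ i, L ν i := by
  simp only [L, Finset.sum_apply, Pi.smul_apply]
  rw [Finset.sum_comm, Finsupp.degree_eq_sum]
  push_cast
  refine Finset.sum_le_sum fun q _ => ?_
  rw [← Finset.smul_sum, nsmul_eq_mul]
  have := (hΩ q.1 q.2 q.2.2).2.2
  nlinarith [Int.natCast_nonneg (ν q)]

/-- Homogeneity of weight `w`, where `x_i` has weight `e_i` and the parameter `a^{(k)}_ī` has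
weight `-ī`: every term `a^ν x^d` satisfies `d - L(ν) = w`. -/
def IsWeightHomogeneous (w : Fin n → ℤ) (f : MvPowerSeries (Fin n) (ParamRing F Ω)) : Prop :=
  ∀ d ν, (coeff d f).coeff ν ≠ 0 → ∀ i, (d i : ℤ) - L ν i = w i

namespace IsWeightHomogeneous

variable {w w' : Fin n → ℤ} {f g : MvPowerSeries (Fin n) (ParamRing F Ω)}

theorem sub (hf : IsWeightHomogeneous w f) (hg : IsWeightHomogeneous w g) :
    IsWeightHomogeneous w (f - g) := by
  intro d ν h
  by_cases h1 : (coeff d f).coeff ν = 0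
  · refine hg d ν fun h2 => h ?_
    rw [map_sub, MvPolynomial.coeff_sub, h1, h2, sub_zero]
  · exact hf d ν h1

theorem sum {ι : Type*} {s : Finset ι} {f : ι → MvPowerSeries (Fin n) (ParamRing F Ω)}
    (hf : ∀ i ∈ s, IsWeightHomogeneous w (f i)) : IsWeightHomogeneous w (∑ i ∈ s, f i) := by
  intro d ν h
  rw [map_sum, MvPolynomial.coeff_sum] at h
  obtain ⟨i, hi, h⟩ := Finset.exists_ne_zero_of_sum_ne_zero h
  exact hf i hi d ν h

theorem mul (hf : IsWeightHomogeneous w f) (hg : IsWeightHomogeneous w' g) :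
    IsWeightHomogeneous (w + w') (f * g) := by
  classical
  intro d ν h i
  rw [coeff_mul, MvPolynomial.coeff_sum] at h
  obtain ⟨de, hde, h⟩ := Finset.exists_ne_zero_of_sum_ne_zero h
  rw [MvPolynomial.coeff_mul] at h
  obtain ⟨kl, hkl, h⟩ := Finset.exists_ne_zero_of_sum_ne_zero h
  rw [HasAntidiagonal.mem_antidiagonal] at hde hkl
  rw [← hde, ← hkl, L_add, Pi.add_apply, Pi.add_apply, Finsupp.add_apply, Nat.cast_add,
    ← hf _ _ (left_ne_zero_of_mul h) i, ← hg _ _ (right_ne_zero_of_mul h) i]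
  ring

theorem pderiv (hf : IsWeightHomogeneous w f) (j : Fin n) :
    IsWeightHomogeneous (w - Pi.single j 1) (MvPowerSeries.pderiv (ParamRing F Ω) j f) := by
  classical
  intro d ν h i
  rw [coeff_pderiv, ← Nat.cast_add_one, mul_comm, ← nsmul_eq_mul, MvPolynomial.coeff_smul] at h
  rw [Pi.sub_apply, ← hf _ _ (right_ne_zero_of_smul h) i, Finsupp.add_apply]
  by_cases hij : i = j
  · subst hij
    simp
    ring
  · simp [hij]

theorem X (i : Fin n) :
    IsWeightHomogeneous (Pi.single i 1) (X i : MvPowerSeries (Fin n) (ParamRing F Ω)) := by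
  classical
  intro d ν h j
  rw [coeff_X] at h
  split_ifs at h with hd
  · rw [MvPolynomial.coeff_one] at h
    split_ifs at h with hν
    · rw [hd, ← hν, L_zero, Finsupp.single_apply, Pi.single_apply]
      simp [eq_comm]
    · exact absurd rfl h
  · exact absurd (MvPolynomial.coeff_zero _) h

theorem lieDerivative {h : VField n (ParamRing F Ω)}
    (hh : ∀ i, IsWeightHomogeneous (Pi.single i 1) (h i)) (hf : IsWeightHomogeneous w f) :
    IsWeightHomogeneous w (lieDerivative h f) := by
  rw [lieDerivative_apply]
  refine sum fun i _ => ?_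
  have := (hh i).mul (hf.pderiv i)
  rwa [add_sub_cancel] at this

theorem map_lieSeries [CharZero F] {h : VField n (ParamRing F Ω)} (ho : ∀ i, 2 ≤ (h i).order)
    (hh : ∀ i, IsWeightHomogeneous (Pi.single i 1) (h i)) (hf : IsWeightHomogeneous w f) :
    IsWeightHomogeneous w (MvPowerSeries.map (Polynomial.evalRingHom 1) (lieSeries h f)) := by
  intro d ν hd
  rw [coeff_map_eval_one_lieSeries ho f d d.degree.lt_succ_self, MvPolynomial.coeff_sum] at hd
  obtain ⟨k, -, hk⟩ := Finset.exists_ne_zero_of_sum_ne_zero hd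
  rw [MvPolynomial.coeff_smul] at hk
  have : IsWeightHomogeneous w ((LevelNormalForm.lieDerivative h)^[k] f) := by
    clear hk hd
    induction k with
    | zero => exact hf
    | succ k ih =>
      rw [Function.iterate_succ_apply']
      exact ih.lieDerivative hh
  exact this d ν (right_ne_zero_of_smul hk)

end IsWeightHomogeneous

/-- The module `M` consists of the vector fields whose `j`-th component has the weight of `x_j`.
The membership of the exponents in `𝓜` is automatic. -/
theorem mem_fieldModule_iff (hΩ : Admissible Ω) {Θ : VField n (ParamRing F Ω)} :
    Θ ∈ fieldModule F Ω ↔ ∀ j, IsWeightHomogeneous (Pi.single j 1) (Θ j) := by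
  constructor
  · intro h j d ν hd i
    have h0 : coeff d (Θ j) ≠ 0 := fun h0 => hd (by rw [h0, MvPolynomial.coeff_zero])
    rw [(h j d h0).2.2 ν (MvPolynomial.mem_support_iff.mpr hd), shifted]
    ring
  · intro h j d hd
    have hL : IsMPolynomial (shifted d j) (coeff d (Θ j)) := by
      intro ν hν
      ext i
      have := h j d ν (MvPolynomial.mem_support_iff.mp hν) i
      rw [shifted, ← this]
      ring
    obtain ⟨ν, hν⟩ := MvPolynomial.support_nonempty.mpr hd
    have h1 : ∀ i, i ≠ j → 0 ≤ shifted d j i := by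
      intro i hi
      simp [shifted, hi]
    have h2 : -1 ≤ shifted d j j := by
      rw [shifted, Pi.single_eq_same]
      linarith [Int.natCast_nonneg (d j)]
    refine ⟨⟨fun i => ?_, ?_, ⟨ν, hL ν hν⟩, fun i k hi hk => ?_⟩, h1, hL⟩
    · by_cases hi : i = j
      · rwa [hi]
      · linarith [h1 i hi]
    · rw [← hL ν hν]
      exact (Int.natCast_nonneg _).trans (hΩ.degree_le_sum_L ν)
    · have e : ∀ i, shifted d j i = -1 → i = j := by
        intro i hi
        by_contra hij
        linarith [h1 i hij]
      rw [e i hi, e k hk]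

/-! ### Levels -/

/-- The terms of level at least `s` are those whose coefficients lie in the `s`-th power of the
ideal generated by the parameters. -/
theorem mem_coeffIdeal_level_iff {s : ℕ} {f : MvPowerSeries (Fin n) (ParamRing F Ω)} :
    f ∈ coeffIdeal (MvPolynomial.idealOfVars (Param Ω) F ^ s) ↔
      ∀ d ν, ν.degree < s → (coeff d f).coeff ν = 0 := by
  simp only [mem_coeffIdeal, MvPolynomial.mem_pow_idealOfVars_iff']

/-- A term `a^ν x^d` of weight `e_j` has `|d| = |L(ν)| + 1`, and `|L(ν)| ≥ |ν|`. -/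
theorem add_one_le_order_of_level (hΩ : Admissible Ω) {s : ℕ} {j : Fin n}
    {f : MvPowerSeries (Fin n) (ParamRing F Ω)} (hw : IsWeightHomogeneous (Pi.single j 1) f)
    (hf : f ∈ coeffIdeal (MvPolynomial.idealOfVars (Param Ω) F ^ s)) :
    (s + 1 : ℕ) ≤ f.order := by
  refine nat_le_order fun d hd => ?_
  ext ν
  rw [MvPolynomial.coeff_zero]
  by_contra hν
  have h1 : s ≤ ν.degree := not_lt.mp fun h => hν (mem_coeffIdeal_level_iff.mp hf d ν h)
  have h2 : ∑ i, ((d i : ℤ) - L ν i) = ∑ i, (Pi.single j 1 : Fin n → ℤ) i :=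
    Finset.sum_congr rfl fun i _ => hw d ν hν i
  rw [Finset.sum_sub_distrib, Finset.sum_pi_single', if_pos (mem_univ j)] at h2
  have h3 := hΩ.degree_le_sum_L ν
  rw [Finsupp.degree_eq_sum] at hd
  zify at hd h1
  linarith

end Grading

section Homological

variable {F : Type*} [Field F] {n : ℕ} {Ω : Fin n → Finset (Fin n → ℤ)}

/-! ### The solution of the homological equation -/

theorem coe_exponent {μ : Param Ω →₀ ℕ} {j : Fin n} (h : IsMonomialAt μ j) (i : Fin n) :
    (exponent μ j i : ℤ) = L μ i + (Pi.single j 1 : Fin n → ℤ) i :=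
  Int.toNat_of_nonneg (h i)

theorem isWeightHomogeneous_termField (θ : Fin n → F) (μ : Param Ω →₀ ℕ) (j : Fin n) :
    IsWeightHomogeneous (Pi.single j 1) (termField θ μ j) := by
  classical
  intro d ν hd i
  rw [termField] at hd
  split_ifs at hd with hμ
  · rw [coeff_monomial] at hd
    split_ifs at hd with hd'
    · rw [MvPolynomial.coeff_monomial] at hd
      split_ifs at hd with hν
      · rw [hd', coe_exponent hμ, hν]
        ring
      · exact absurd rfl hd
    · exact absurd (MvPolynomial.coeff_zero _) hd
  · exact absurd (by simp) hd

theorem termField_mem_level (θ : Fin n → F) (μ : Param Ω →₀ ℕ) (j : Fin n) :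
    termField θ μ j ∈ coeffIdeal (MvPolynomial.idealOfVars (Param Ω) F ^ μ.degree) := by
  classical
  refine mem_coeffIdeal_level_iff.mpr fun d ν hν => ?_
  rw [termField]
  split_ifs
  · rw [coeff_monomial]
    split_ifs
    · rw [MvPolynomial.coeff_monomial, if_neg]
      rintro rfl
      exact lt_irrefl _ hν
    · exact MvPolynomial.coeff_zero _
  · simp

theorem coeff_coeff_termField_self (θ : Fin n → F) {μ : Param Ω →₀ ℕ} {j : Fin n}
    (h : IsMonomialAt μ j) : (coeff (exponent μ j) (termField θ μ j)).coeff μ = θ j := by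
  classical
  rw [termField, if_pos h, coeff_monomial_same, MvPolynomial.coeff_monomial, if_pos rfl]

theorem coeff_coeff_termField_of_ne (θ : Fin n → F) {μ ν : Param Ω →₀ ℕ} (h : μ ≠ ν) (j : Fin n)
    (d : Fin n →₀ ℕ) : (coeff d (termField θ μ j)).coeff ν = 0 := by
  classical
  rw [termField]
  split_ifs
  · rw [coeff_monomial]
    split_ifs
    · rw [MvPolynomial.coeff_monomial, if_neg h]
    · exact MvPolynomial.coeff_zero _
  · simp

variable (lam : Fin n → F) (s : ℕ) (a : VField n (ParamRing F Ω))

theorem isWeightHomogeneous_homologicalSolution (j : Fin n) :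
    IsWeightHomogeneous (Pi.single j 1) (homologicalSolution lam s a j) := by
  rw [homologicalSolution, Finset.sum_apply]
  exact .sum fun μ _ => isWeightHomogeneous_termField _ μ j

theorem mem_finsuppAntidiag_univ_iff {μ : Param Ω →₀ ℕ} {s : ℕ} :
    μ ∈ (Finset.univ : Finset (Param Ω)).finsuppAntidiag s ↔ μ.degree = s := by
  rw [mem_finsuppAntidiag, Finsupp.degree_eq_sum]
  simp

theorem homologicalSolution_mem_level (j : Fin n) : homologicalSolution lam s a j ∈
    coeffIdeal (MvPolynomial.idealOfVars (Param Ω) F ^ s) := by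
  classical
  rw [homologicalSolution, Finset.sum_apply]
  refine Ideal.sum_mem _ fun μ hμ => ?_
  rw [← mem_finsuppAntidiag_univ_iff.mp (Finset.mem_filter.mp hμ).1]
  exact termField_mem_level _ μ j

theorem two_le_order_homologicalSolution (hΩ : Admissible Ω) {s : ℕ} (hs : 1 ≤ s) (j : Fin n) :
    2 ≤ (homologicalSolution lam s a j).order := by
  refine le_trans ?_ (add_one_le_order_of_level hΩ
    (isWeightHomogeneous_homologicalSolution lam s a j) (homologicalSolution_mem_level lam s a j))
  exact_mod_cast Nat.succ_le_succ hs

theorem coeff_coeff_homologicalSolution {μ : Param Ω →₀ ℕ} {j : Fin n} (hj : IsMonomialAt μ j)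
    (hμ : pairing (L μ) lam ≠ 0) :
    (coeff (exponent μ j) (homologicalSolution lam μ.degree a j)).coeff μ =
      (pairing (L μ) lam)⁻¹ * (coeff (exponent μ j) (a j)).coeff μ := by
  classical
  rw [homologicalSolution, Finset.sum_apply, map_sum, MvPolynomial.coeff_sum,
    Finset.sum_eq_single μ]
  · rw [coeff_coeff_termField_self _ hj, Pi.smul_apply, termCoeff, if_pos hj, smul_eq_mul]
  · intro ν _ hν
    exact coeff_coeff_termField_of_ne _ hν _ _
  · intro h
    exact absurd (Finset.mem_filter.mpr ⟨mem_finsuppAntidiag_univ_iff.mpr rfl, hμ⟩) h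

/-! ### The linear part -/

/-- Monomials are eigenvectors of the derivation of a diagonal linear vector field. -/
theorem coeff_lieDerivative_linearField (f : MvPowerSeries (Fin n) (ParamRing F Ω))
    (d : Fin n →₀ ℕ) : coeff d (lieDerivative (linearField Ω lam) f) =
      MvPolynomial.C (∑ i, (d i : F) * lam i) * coeff d f := by
  classical
  rw [lieDerivative_apply, map_sum, map_sum, Finset.sum_mul]
  refine Finset.sum_congr rfl fun i _ => ?_
  rw [linearField, mul_assoc, coeff_C_mul, X, coeff_monomial_mul, one_mul]
  split_ifs with hi
  · have hd : d - Finsupp.single i 1 + Finsupp.single i 1 = d := tsub_add_cancel_of_le hi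
    rw [coeff_pderiv, hd, ← Nat.cast_add_one]
    have : (d - Finsupp.single i 1 : Fin n →₀ ℕ) i + 1 = d i := by
      simpa using DFunLike.congr_fun hd i
    rw [this, map_mul, map_natCast]
    ring
  · have : d i = 0 := by
      by_contra h
      exact hi (Finsupp.single_le_iff.mpr (Nat.one_le_iff_ne_zero.mpr h))
    simp [this]

variable {lam a}

theorem IsEquation.sub_linearField_mem_level (ha : IsEquation lam a) (j : Fin n) :
    a j - linearField Ω lam j ∈ coeffIdeal (MvPolynomial.idealOfVars (Param Ω) F ^ 1) := by
  refine mem_coeffIdeal_level_iff.mpr fun d ν hν => ?_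
  have h : MvPolynomial.homogeneousComponent 0 (coeff d (a j)) = coeff d (linearField Ω lam j) :=
    congrFun (congrFun ha.zero j) d
  rw [map_sub, MvPolynomial.coeff_sub, ← h, MvPolynomial.coeff_homogeneousComponent,
    if_pos (by omega), sub_self]

theorem levelPart_zero_congr {b : VField n (ParamRing F Ω)}
    (h : ∀ j, b j - a j ∈ coeffIdeal (MvPolynomial.idealOfVars (Param Ω) F ^ 1)) :
    levelPart 0 b = levelPart 0 a := by
  funext j d
  simp only [levelPart]
  ext ν
  rw [MvPolynomial.coeff_homogeneousComponent, MvPolynomial.coeff_homogeneousComponent]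
  split_ifs with hν
  · have := mem_coeffIdeal_level_iff.mp (h j) d ν (by omega)
    rwa [map_sub, MvPolynomial.coeff_sub, sub_eq_zero] at this
  · rfl

/-! ### The transformed equation -/

/-- The transformed vector field is homogeneous: this follows degree by degree from
`b = a ∘ H - (DH - 1) b`, since the entries of `DH - 1` have no constant term. -/
theorem IsTransformed.isWeightHomogeneous {a H b : VField n (ParamRing F Ω)}
    (hb : IsTransformed a H b) (hH : IsNearIdentity H)
    (hHw : ∀ i, IsWeightHomogeneous (Pi.single i 1) (H i))
    (haw : ∀ i, IsWeightHomogeneous (Pi.single i 1) (subst H (a i))) (i : Fin n) :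
    IsWeightHomogeneous (Pi.single i 1) (b i) := by
  classical
  intro d
  induction hN : d.degree using Nat.strong_induction_on generalizing d i with
  | _ N ih =>
  subst hN
  intro ν hν k
  rw [hb.eq_sub i, map_sub, MvPolynomial.coeff_sub] at hν
  by_cases h0 : (coeff d (subst H (a i))).coeff ν = 0
  swap
  · exact haw i d ν h0 k
  rw [h0, zero_sub, neg_ne_zero, map_sum, MvPolynomial.coeff_sum] at hν
  obtain ⟨j, -, hν⟩ := Finset.exists_ne_zero_of_sum_ne_zero hν
  rw [coeff_mul, MvPolynomial.coeff_sum] at hν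
  obtain ⟨⟨d₁, d₂⟩, hde, hν⟩ := Finset.exists_ne_zero_of_sum_ne_zero hν
  rw [MvPolynomial.coeff_mul] at hν
  obtain ⟨⟨ν₁, ν₂⟩, hνe, hν⟩ := Finset.exists_ne_zero_of_sum_ne_zero hν
  rw [HasAntidiagonal.mem_antidiagonal] at hde hνe
  have h1 := left_ne_zero_of_mul hν
  have hd₁ : d₁.degree ≠ 0 := by
    intro h
    rw [Finsupp.degree_eq_zero_iff] at h
    simp only [h, coeff_pderiv] at h1
    rw [map_sub, hH i _ (by simp), sub_self, zero_mul, MvPolynomial.coeff_zero] at h1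
    exact h1 rfl
  have hlt : d₂.degree < d.degree := by
    rw [← hde, map_add]
    exact Nat.lt_add_of_pos_left (Nat.pos_of_ne_zero hd₁)
  have e1 := ((hHw i).sub (.X i)).pderiv j d₁ ν₁ h1 k
  have e2 := ih _ hlt j d₂ rfl ν₂ (right_ne_zero_of_mul hν) k
  rw [← hde, ← hνe, L_add, Pi.add_apply, Finsupp.add_apply, Nat.cast_add]
  rw [Pi.sub_apply] at e1
  linarith

theorem lieDerivative_linearField (h : VField n (ParamRing F Ω)) (i : Fin n) :
    lieDerivative h (linearField Ω lam i) = C (MvPolynomial.C (lam i)) * h i := by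
  rw [linearField, ← smul_eq_C_mul, Derivation.map_smul, lieDerivative_X, smul_eq_C_mul]

/-- The Lie bracket with `λ ⊙ x` multiplies the term with index `μ` by `-⟨L(μ), λ⟩`. -/
theorem coeff_coeff_bracket_linearField (h : VField n (ParamRing F Ω)) {μ : Param Ω →₀ ℕ}
    {j : Fin n} (hj : IsMonomialAt μ j) :
    (coeff (exponent μ j) (lieDerivative h (linearField Ω lam j) -
        lieDerivative (linearField Ω lam) (h j))).coeff μ =
      -pairing (L μ) lam * (coeff (exponent μ j) (h j)).coeff μ := by
  rw [map_sub, lieDerivative_linearField, coeff_C_mul, coeff_lieDerivative_linearField,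
    MvPolynomial.coeff_sub, MvPolynomial.coeff_C_mul, MvPolynomial.coeff_C_mul, ← sub_mul]
  congr 1
  have e : ∀ i, (exponent μ j i : F) = (L μ i : F) + ((Pi.single j 1 : Fin n → ℤ) i : F) := by
    intro i
    exact_mod_cast congrArg (Int.cast : ℤ → F) (coe_exponent hj i)
  simp only [e, add_mul, Finset.sum_add_distrib, pairing]
  rw [Finset.sum_eq_single (s := univ)
    (f := fun i => ((Pi.single j 1 : Fin n → ℤ) i : F) * lam i) j]
  · rw [Pi.single_eq_same, Int.cast_one, one_mul]
    ring
  · intro i _ hi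
    rw [Pi.single_eq_of_ne hi, Int.cast_zero, zero_mul]
  · simp

/-- In level `s` the bracket of `λ ⊙ x` with the homological solution cancels exactly the
non-resonant terms, and the lower levels are those of `a`. -/
theorem InNormalForm.of_sub_mem_level {b : VField n (ParamRing F Ω)} {s : ℕ}
    (hnf : InNormalForm lam (s - 1) a)
    (h₁ : ∀ j, b j - a j ∈ coeffIdeal (MvPolynomial.idealOfVars (Param Ω) F ^ s))
    (h₂ : ∀ j, b j - (a j + lieDerivative (homologicalSolution lam s a) (linearField Ω lam j) -
        lieDerivative (linearField Ω lam) (homologicalSolution lam s a j)) ∈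
          coeffIdeal (MvPolynomial.idealOfVars (Param Ω) F ^ (s + 1))) :
    InNormalForm lam s b := by
  intro μ hμ1 hμs hμ
  funext j
  rw [termCoeff, Pi.zero_apply]
  split_ifs with hj
  swap
  · rfl
  rcases hμs.lt_or_eq with hlt | rfl
  · have h := mem_coeffIdeal_level_iff.mp (h₁ j) (exponent μ j) μ hlt
    rw [map_sub, MvPolynomial.coeff_sub, sub_eq_zero] at h
    have h0 := congrFun (hnf μ hμ1 (by omega) hμ) j
    rw [termCoeff, if_pos hj] at h0
    rw [h, h0, Pi.zero_apply]
  · have h := mem_coeffIdeal_level_iff.mp (h₂ j) (exponent μ j) μ (Nat.lt_succ_self _)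
    rw [add_sub_assoc, map_sub, map_add, MvPolynomial.coeff_sub, MvPolynomial.coeff_add,
      coeff_coeff_bracket_linearField _ hj, coeff_coeff_homologicalSolution _ _ hj hμ,
      sub_eq_zero] at h
    rw [h, neg_mul, mul_inv_cancel_left₀ hμ, add_neg_cancel]

end Homological

theorem isNearIdentity_timeOne {n : ℕ} {R : Type*} [CommRing R] [Algebra ℚ R] {h : VField n R}
    (ho : ∀ i, 2 ≤ (h i).order) : IsNearIdentity (atTime 1 fun i => lieSeries h (X i)) := by
  intro i d hd
  rw [atTime, coeff_map_eval_one_lieSeries ho (X i) d (N := 2) (by omega), sum_range_succ,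
    sum_range_one, Function.iterate_one, lieDerivative_X,
    coeff_of_lt_order (lt_of_lt_of_le (by exact_mod_cast Nat.lt_succ_of_le hd) (ho i))]
  simp

end LevelNormalForm

end

open LevelNormalForm
theorem theorem1 {F : Type*} [Field F] [CharZero F] {n : ℕ}
    (Ω : Fin n → Finset (Fin n → ℤ)) (hΩ : Admissible Ω)
    (lam : Fin n → F) (a : VField n (ParamRing F Ω)) (ha : IsEquation lam a)
    (s : ℕ) (hs : 1 ≤ s) (hnf : InNormalForm lam (s - 1) a) :
    (∃! ψ, IsFlow (homologicalSolution lam s a) ψ) ∧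
    ∀ H, IsTimeOneFlow (homologicalSolution lam s a) H →
      IsNearIdentity H ∧ (∃! b, IsTransformed a H b) ∧
      ∀ b, IsTransformed a H b → IsEquation lam b ∧ InNormalForm lam s b := by
  have ho := two_le_order_homologicalSolution lam a hΩ hs
  have hw := isWeightHomogeneous_homologicalSolution lam s a
  have hl := homologicalSolution_mem_level lam s a
  have haw := (mem_fieldModule_iff hΩ).mp ha.mem
  refine ⟨⟨_, isFlow_lieSeries ho, fun ψ hψ => isFlow_unique ho hψ (isFlow_lieSeries ho)⟩, ?_⟩
  intro H hH
  have hH := hH.eq_atTime_lieSeries ho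
  have hHn : IsNearIdentity H := hH ▸ isNearIdentity_timeOne ho
  refine ⟨hHn, hHn.existsUnique_isTransformed a, fun b hb => ?_⟩
  have hlev := hb.sub_mem_coeffIdeal ho hs hl ha.sub_linearField_mem_level hH
  refine ⟨⟨(mem_fieldModule_iff hΩ).mpr (hb.isWeightHomogeneous hHn ?_ ?_), ?_⟩,
    hnf.of_sub_mem_level (fun j => (hlev j).1) fun j => (hlev j).2⟩
  · intro i
    rw [hH]
    exact IsWeightHomogeneous.map_lieSeries ho hw (.X i)
  · intro i
    rw [hH, subst_atTime_one_lieSeries ho]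
    exact IsWeightHomogeneous.map_lieSeries ho hw (haw i)
  · rw [← ha.zero]
    exact levelPart_zero_congr fun j =>
      coeffIdeal_mono (Ideal.pow_le_pow_right hs) (hlev j).1
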